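/- Let $\mathcal N$ be a countable index set and $\ell^p=\ell^p(\mathcal N)$, $1\le p\le\infty$, the usual spaces of real families. Let $\mathcal A$ be a Banach algebra of real matrices $(a(i,j))_{i,j\in\mathcal N}$ under matrix multiplication (the norm $\|\cdot\|_{\mathcal A}$ is complete and $\|AB\|_{\mathcal A}\le K\|A\|_{\mathcal A}\|B\|_{\mathcal A}$ for some constant $K$) that is a Banach subalgebra of $\mathcal B(\ell^q)$ for every $1\le q\le\infty$: each $A\in\mathcal A$ acts on $\ell^q$ as a bounded operator and $\sup_{\|A\|_{\mathcal A}\le1}\|A\|_{\mathcal B(\ell^q)}<\infty$. Assume that: (a) $\mathcal A$ admits norm control in $\mathcal B(\ell^2)$: there is a continuous function $h:[0,\infty)\times[0,\infty)\to[0,\infty)$ such that for each $A\in\mathcal A$ with an inverse $A^{-1}\in\mathcal B(\ell^2)$ one has $A^{-1}\in\mathcal A$ and $\|A^{-1}\|_{\mathcal A}\le h(\|A\|_{\mathcal A},\|A^{-1}\|_{\mathcal B(\ell^2)})$; (b) there are nested finite sets $\mathcal N_1\subset\mathcal N_2\subset\cdots$ with $\bigcup_m\mathcal N_m=\mathcal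 N$ such that, with $P_mx=(x(n)\chi_{\mathcal N_m}(n))_{n\in\mathcal N}$, $$\lim_{m\to\infty}\ \sup_{\|A\|_{\mathcal A}\le1}\|P_mA(I-P_{m+1})\|_{\mathcal B(\ell^\infty)}=0 .$$ For a map $g:\ell^p\to\ell^p$ we say that its gradient is bounded and continuous in $\mathcal A$ if for each $x\in\ell^p$ there is $\nabla g(x)\in\mathcal A$ with $\nabla g(x)c=\lim_{t\to0}(g(x+tc)-g(x))/t$ in $\ell^p$ for all $c\in\ell^p$, $\sup_{x\in\ell^p}\|\nabla g(x)\|_{\mathcal A}<\infty$, and $x\mapsto\nabla g(x)$ is continuous from $\ell^p$ to $\mathcal A$. A map $\ell^p\to\ell^p$ is continuously invertible if it is a homeomorphism of $\ell^p$ for the norm topology. Let $2\le p_0\le\infty$, and let $f:\ell^{p_0}\to\ell^{p_0}$ be continuous with $f(0)=0$, with gradient bounded and continuous in $\mathcal A$, and such that for some $m_0>0$ $$c^T\nabla f(x)c\ \ge\ m_0\,c^Tc\qquad\text{for all }c\in\ell^2\text{ and }x\in\ell^{p_0}.$$ Then: (i) for every $1\le p\le p_0$, $f$ maps $\ell^p$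 into $\ell^p$, its restriction to $\ell^p$ is continuously invertible on $\ell^p$, and the gradient of the inverse of this restriction is bounded and continuous in $\mathcal A$ (in particular, for $p=p_0$, $f$ has an inverse $f^{-1}$ on $\ell^{p_0}$ and $\nabla f^{-1}$ is bounded and continuous in $\mathcal A$); (ii) for every $p_0<p\le\infty$, $f$ extends to a continuously invertible map $F:\ell^p\to\ell^p$ such that, for all $x,x'\in\ell^p$, $$\|F(x)-F(x')\|_p\le\Big(\sup_{z\in\ell^{p_0}}\|\nabla f(z)\|_{\mathcal A}\Big)\Big(\sup_{\|A\|_{\mathcal A}\le1}\|A\|_{\mathcal B(\ell^p)}\Big)\|x-x'\|_p,$$ $$\|F^{-1}(x)-F^{-1}(x')\|_p\le\Big(\sup_{z\in\ell^{p_0}}\|\nabla f^{-1}(z)\|_{\mathcal A}\Big)\Big(\sup_{\|A\|_{\mathcal A}\le1}\|A\|_{\mathcal B(\ell^p)}\Big)\|x-x'\|_p.$$ -/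

import Mathlib

open Filter Topology
open scoped ENNReal NNReal

noncomputable section

/-- The space `ℓ^p` of real families indexed by `ι`, with its usual norm. -/
abbrev Ell (ι : Type*) (p : ℝ≥0∞) : Type _ := lp (fun _ : ι => ℝ) p

namespace Ell

variable {ι : Type*}

/-- The inclusion `ℓ^p ⊆ ℓ^q` for `p ≤ q`. -/
def incl {p q : ℝ≥0∞} (h : p ≤ q) (x : Ell ι p) : Ell ι q :=
  ⟨fun i => x i, (lp.memℓp x).of_exponent_ge h⟩

/-- The coordinate projection `P_S` on `ℓ^∞`: it keeps the coordinates in the finite set `S` and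
replaces all the others by `0`. -/
def proj (S : Finset ι) : Ell ι ∞ →L[ℝ] Ell ι ∞ :=
  LinearMap.mkContinuous
    { toFun := fun x => ⟨Set.indicator (S : Set ι) (fun i => x i), by
        refine memℓp_infty ⟨‖x‖, ?_⟩
        rintro _ ⟨i, rfl⟩
        exact (norm_indicator_le_norm_self _ _).trans (lp.norm_apply_le_norm (by simp) x i)⟩
      map_add' := fun x y => by
        ext i
        exact congrFun (Set.indicator_add (S : Set ι) (fun i => x i) (fun i => y i)) i
      map_smul' := fun c x => by
        ext i
        by_cases hi : i ∈ S <;> simp [hi] }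
    1
    (fun x => by
      rw [one_mul]
      refine lp.norm_le_of_forall_le (norm_nonneg x) fun i => ?_
      exact (norm_indicator_le_norm_self _ _).trans (lp.norm_apply_le_norm (by simp) x i))

theorem proj_apply (S : Finset ι) (x : Ell ι ∞) (i : ι) :
    proj S x i = Set.indicator (S : Set ι) (fun j => x j) i := rfl

end Ell

/-- A structure of algebra of infinite matrices on a normed space `𝒜`: the elements of `𝒜` are
(through the injective linear map `mat`) matrices indexed by `ι × ι`, `𝒜` is closed under the matrix
product and the product is continuous for the norm of `𝒜` (so `‖ab‖ ≤ K ‖a‖ ‖b‖`; neither `K = 1`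
nor a unit is required), and for every `1 ≤ q ≤ ∞` each matrix in `𝒜` acts on `ℓ^q` as a bounded
operator, the embedding `𝒜 → B(ℓ^q)` being continuous. For complete `𝒜` this says that `𝒜` is a
Banach subalgebra of `B(ℓ^q)` for every `1 ≤ q ≤ ∞`. The maps `mul` and `op` are determined by
`mat`. -/
structure MatrixAlgebra (ι : Type*) (𝒜 : Type*) [NormedAddCommGroup 𝒜] [NormedSpace ℝ 𝒜] where
  /-- The matrix of an element. -/
  mat : 𝒜 →ₗ[ℝ] Matrix ι ι ℝ
  mat_injective : Function.Injective mat
  /-- The matrix product. -/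
  mul : 𝒜 →L[ℝ] 𝒜 →L[ℝ] 𝒜
  hasSum_mul : ∀ (a b : 𝒜) (i k : ι),
    HasSum (fun j => mat a i j * mat b j k) (mat (mul a b) i k)
  /-- The bounded operator on `ℓ^q` given by the matrix of an element. -/
  op : ∀ (q : ℝ≥0∞) [Fact (1 ≤ q)], 𝒜 →L[ℝ] (Ell ι q →L[ℝ] Ell ι q)
  hasSum_op : ∀ (q : ℝ≥0∞) [Fact (1 ≤ q)] (a : 𝒜) (x : Ell ι q) (i : ι),
    HasSum (fun j => mat a i j * x j) (op q a x i)

namespace MatrixAlgebra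

variable {ι : Type*} {𝒜 : Type*} [NormedAddCommGroup 𝒜] [NormedSpace ℝ 𝒜]

/-- `𝒜` is inverse-closed in `B(ℓ²)` with norm control: there is a continuous
`h : [0,∞) × [0,∞) → [0,∞)` such that, whenever `a ∈ 𝒜` has an inverse `T` in `B(ℓ²)`, this inverse
belongs to `𝒜` and `‖a⁻¹‖_𝒜 ≤ h (‖a‖_𝒜, ‖a⁻¹‖_{B(ℓ²)})`. -/
def AdmitsNormControl (M : MatrixAlgebra ι 𝒜) : Prop :=
  ∃ h : ℝ≥0 × ℝ≥0 → ℝ≥0, Continuous h ∧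
    ∀ (a : 𝒜) (T : Ell ι 2 →L[ℝ] Ell ι 2), M.op 2 a * T = 1 → T * M.op 2 a = 1 →
      ∃ b : 𝒜, M.op 2 b = T ∧ ‖b‖₊ ≤ h (‖a‖₊, ‖T‖₊)

/-- The constant `sup_{‖a‖_𝒜 ≤ 1} ‖a‖_{B(ℓ^p)}`. -/
def embConst (M : MatrixAlgebra ι 𝒜) (p : ℝ≥0∞) [Fact (1 ≤ p)] : ℝ :=
  ⨆ a : Metric.closedBall (0 : 𝒜) 1, ‖M.op p a‖

/-- There are nested finite sets `S 0 ⊆ S 1 ⊆ …` exhausting the index set such that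
`sup_{‖a‖_𝒜 ≤ 1} ‖P_{S m} a (1 - P_{S (m+1)})‖_{B(ℓ^∞)} → 0` as `m → ∞`. -/
def BandApproximable (M : MatrixAlgebra ι 𝒜) : Prop :=
  ∃ S : ℕ → Finset ι, (∀ m, S m ⊆ S (m + 1)) ∧ (∀ i, ∃ m, i ∈ S m) ∧
    Tendsto
      (fun m => ⨆ a : Metric.closedBall (0 : 𝒜) 1,
        ‖Ell.proj (S m) * M.op ∞ (a : 𝒜) * (1 - Ell.proj (S (m + 1)))‖)
      atTop (𝓝 0)

/-- `G x ∈ 𝒜` is the gradient of `g : ℓ^p → ℓ^p` at every `x`, i.e.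
`G x c = lim_{t → 0} (g (x + t c) - g x) / t` in `ℓ^p` for all `x, c ∈ ℓ^p`, and `G` is bounded
and continuous as a map from `ℓ^p` to `𝒜`. -/
structure HasBoundedContGradient (M : MatrixAlgebra ι 𝒜) {p : ℝ≥0∞} [Fact (1 ≤ p)]
    (g : Ell ι p → Ell ι p) (G : Ell ι p → 𝒜) : Prop where
  gradient : ∀ x c : Ell ι p, HasLineDerivAt ℝ g (M.op p (G x) c) x c
  bounded : ∃ C : ℝ, ∀ x, ‖G x‖ ≤ C
  continuous : Continuous G

end MatrixAlgebra

end

/-!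
The increments of `f` are given by elements of `𝒜`: by the fundamental theorem of calculus
`f x - f y = a (x - y)`, where `a = ∫₀¹ G (y + t (x - y)) dt` is a Bochner integral in `𝒜`
(`HasBoundedContGradient.sub_eq`). Coercivity on `ℓ²` is a closed convex condition, so `a` inherits
it, and is invertible on `ℓ²` by the Lax–Milgram theorem with `‖a⁻¹‖ ≤ 1 / m₀`. Norm control then
gives `a⁻¹ ∈ 𝒜` with a bound that does not depend on `x` and `y`
(`AdmitsNormControl.exists_inverse`). As the action on `ℓ^q` is multiplicative and determined by the
matrix, `a⁻¹` inverts `a` on every `ℓ^q`.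

For `p ≤ p₀` this shows that `f` restricts to `ℓ^p` and is there bi-Lipschitz and strictly
differentiable with invertible derivative. Its range is open by the inverse function theorem and
closed by completeness, so the restriction is onto
(`exists_homeomorph_of_antilipschitz`); no monotone operator theory is needed. The gradient of the
inverse is the inverse in `𝒜` of the gradient, and is continuous by the resolvent identity.

For `p > p₀` the extension of `f` is the coordinatewise limit of `f` along the truncations of
`x ∈ ℓ^p` to the exhausting finite sets. When `p = ∞` truncations need not converge to `x` in norm,
and the band approximation replaces density: it makes bounded families in `𝒜` equicontinuous for
bounded pointwise convergence (`IsBandExhaustion.tendsto_op_apply_zero`). Hence the limit exists,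
does not depend on the approximating sequence, and the extensions of `f` and `f⁻¹` are inverse to
each other.
-/

open MeasureTheory

/-! ### Inclusions and truncations of sequence spaces -/

namespace Ell

variable {ι : Type*} {p q : ℝ≥0∞}

theorem incl_apply (h : p ≤ q) (x : Ell ι p) (i : ι) : incl h x i = x i := rfl

theorem incl_injective (h : p ≤ q) : Function.Injective (incl h : Ell ι p → Ell ι q) := by
  intro x y hxy
  ext i
  simpa only [incl_apply] using congrArg (fun z : Ell ι q => z i) hxy

theorem incl_sub [Fact (1 ≤ p)] [Fact (1 ≤ q)] (h : p ≤ q) (x y : Ell ι p) :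
    incl h (x - y) = incl h x - incl h y := rfl

theorem incl_self (x : Ell ι p) : incl le_rfl x = x := rfl

theorem abs_apply_le [Fact (1 ≤ p)] (x : Ell ι p) (i : ι) : |x i| ≤ ‖x‖ :=
  lp.norm_apply_le_norm (zero_lt_one.trans_le Fact.out).ne' x i

/-- The `ℓ^q` norm is at most the `ℓ^p` norm for `p ≤ q`, since
`|x i| ^ q ≤ |x i| ^ p * ‖x‖ ^ (q - p)`. -/
theorem norm_incl_le [hp : Fact (1 ≤ p)] (h : p ≤ q) (x : Ell ι p) : ‖incl h x‖ ≤ ‖x‖ := by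
  have hp0 : 0 < p := zero_lt_one.trans_le hp.out
  rcases eq_or_ne q ∞ with rfl | hq
  · exact lp.norm_le_of_forall_le (norm_nonneg x) fun i => abs_apply_le x i
  have hp' : 0 < p.toReal := ENNReal.toReal_pos hp0.ne' (ne_top_of_le_ne_top hq h)
  have hpq : p.toReal ≤ q.toReal := ENNReal.toReal_mono hq h
  have hq' : 0 < q.toReal := hp'.trans_le hpq
  refine lp.norm_le_of_forall_sum_le hq' (norm_nonneg x) fun s => ?_
  have key (r : ℝ) (hr : 0 ≤ r) : r ^ q.toReal = r ^ p.toReal * r ^ (q.toReal - p.toReal) := by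
    rw [← Real.rpow_add_of_nonneg hr hp'.le (sub_nonneg.2 hpq)]
    congr 1
    ring
  calc ∑ i ∈ s, ‖incl h x i‖ ^ q.toReal
      ≤ ∑ i ∈ s, ‖x i‖ ^ p.toReal * ‖x‖ ^ (q.toReal - p.toReal) := by
        refine Finset.sum_le_sum fun i _ => ?_
        rw [incl_apply, key _ (norm_nonneg _)]
        gcongr
        exact abs_apply_le x i
    _ = (∑ i ∈ s, ‖x i‖ ^ p.toReal) * ‖x‖ ^ (q.toReal - p.toReal) := (Finset.sum_mul ..).symm
    _ ≤ ‖x‖ ^ p.toReal * ‖x‖ ^ (q.toReal - p.toReal) := by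
        gcongr
        exact lp.sum_rpow_le_norm_rpow hp' x s
    _ = ‖x‖ ^ q.toReal := (key _ (norm_nonneg x)).symm

theorem continuous_incl [Fact (1 ≤ p)] [Fact (1 ≤ q)] (h : p ≤ q) :
    Continuous (incl h : Ell ι p → Ell ι q) := by
  refine (LipschitzWith.of_dist_le_mul (K := 1) fun x y => ?_).continuous
  rw [dist_eq_norm, dist_eq_norm, ← incl_sub, NNReal.coe_one, one_mul]
  exact norm_incl_le h _

/-- The truncation `x ↦ x · 1_S` to a finite set of coordinates. The result is finitely supported,
so it is regarded as an element of any `ℓ^q`, whatever the space `ℓ^p` of `x`. -/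
noncomputable def trunc (q : ℝ≥0∞) (S : Finset ι) (x : Ell ι p) : Ell ι q :=
  ⟨Set.indicator (S : Set ι) (fun i => x i),
    (memℓp_zero (S.finite_toSet.subset fun i hi => by
      by_contra h
      exact hi (Set.indicator_of_notMem h _))).of_exponent_ge zero_le⟩

theorem trunc_apply (S : Finset ι) (x : Ell ι p) (i : ι) :
    trunc q S x i = Set.indicator (S : Set ι) (fun j => x j) i := rfl

theorem incl_trunc {r : ℝ≥0∞} (h : q ≤ r) (S : Finset ι) (x : Ell ι p) :
    incl h (trunc q S x) = trunc r S x := rfl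

theorem trunc_sub [Fact (1 ≤ p)] [Fact (1 ≤ q)] (S : Finset ι) (x y : Ell ι p) :
    trunc q S (x - y) = trunc q S x - trunc q S y := by
  ext i
  exact congrFun (Set.indicator_sub (S : Set ι) (fun i => x i) (fun i => y i)) i

theorem norm_trunc_le [Fact (1 ≤ p)] (S : Finset ι) (x : Ell ι p) : ‖trunc p S x‖ ≤ ‖x‖ :=
  lp.norm_mono (zero_lt_one.trans_le Fact.out).ne' fun _ => norm_indicator_le_norm_self _ _

theorem tendsto_trunc_apply {S : ℕ → Finset ι} (hS : ∀ m, S m ⊆ S (m + 1))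
    (hS' : ∀ i, ∃ m, i ∈ S m) (x : Ell ι p) (i : ι) :
    Tendsto (fun m => trunc q (S m) x i) atTop (𝓝 (x i)) := by
  obtain ⟨m, hm⟩ := hS' i
  refine tendsto_const_nhds.congr' ?_
  filter_upwards [eventually_ge_atTop m] with n hn
  exact (Set.indicator_of_mem (Finset.mem_coe.2 (monotone_nat_of_le_succ hS hn hm)) _).symm

theorem norm_trunc_le_sum [Fact (1 ≤ p)] (S : Finset ι) (x : Ell ι p) :
    ‖trunc p S x‖ ≤ ∑ j ∈ S, |x j| := by
  classical
  have hsum : trunc p S x = ∑ j ∈ S, lp.single p j (x j) := by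
    ext i
    rw [lp.coeFn_sum, Finset.sum_apply, trunc_apply]
    simp [Set.indicator_apply, Pi.single_apply]
  rw [hsum]
  refine (norm_sum_le _ _).trans (Finset.sum_le_sum fun j _ => ?_)
  rw [lp.norm_single (zero_lt_one.trans_le Fact.out), Real.norm_eq_abs]

end Ell

/-! ### The action of the algebra and its inverses -/

namespace MatrixAlgebra

variable {ι : Type*} {𝒜 : Type*} [NormedAddCommGroup 𝒜] [NormedSpace ℝ 𝒜]
  (M : MatrixAlgebra ι 𝒜) {p q : ℝ≥0∞} [Fact (1 ≤ p)] [Fact (1 ≤ q)]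

theorem op_incl (h : p ≤ q) (a : 𝒜) (x : Ell ι p) :
    M.op q a (Ell.incl h x) = Ell.incl h (M.op p a x) := by
  ext i
  exact (M.hasSum_op q a (Ell.incl h x) i).unique (M.hasSum_op p a x i)

open Classical in
theorem mat_eq_op_single (p : ℝ≥0∞) [Fact (1 ≤ p)] (a : 𝒜) (i j : ι) :
    M.mat a i j = M.op p a (lp.single p j 1) i := by
  refine HasSum.unique ?_ (M.hasSum_op p a (lp.single p j 1) i)
  convert hasSum_single j fun k hk => ?_ using 1
  · simp
  · rw [lp.single_apply_ne p j _ hk, mul_zero]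

theorem op_injective (p : ℝ≥0∞) [Fact (1 ≤ p)] : Function.Injective (M.op p) := by
  intro a b h
  apply M.mat_injective
  ext i j
  rw [mat_eq_op_single M p, mat_eq_op_single M p, h]

/-- Being the identity is a property of the matrix, so it does not depend on the exponent. -/
theorem op_eq_one_of_op_eq_one {a : 𝒜} (h : M.op p a = 1) (q : ℝ≥0∞) [Fact (1 ≤ q)] :
    M.op q a = 1 := by
  classical
  ext x i
  refine (M.hasSum_op q a x i).unique ?_
  have hmat (j : ι) : M.mat a i j = if i = j then 1 else 0 := by
    rw [M.mat_eq_op_single p, h, one_apply_eq_self, lp.single_apply]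
    simp [Pi.single_apply]
  convert hasSum_single i fun k hk => ?_ using 1
  · simp [hmat]
  · simp [hmat, hk.symm]

theorem summable_abs_mat (a : 𝒜) (i : ι) :
    Summable (fun j => |M.mat a i j|) ∧ ∑' j, |M.mat a i j| ≤ ‖M.op ∞ a‖ := by
  -- Test the operator on the sign vector of the `i`-th row.
  let s : Ell ι ∞ := ⟨fun j => (SignType.sign (M.mat a i j) : ℝ), memℓp_infty ⟨1, by
    rintro _ ⟨j, rfl⟩
    rcases lt_trichotomy (M.mat a i j) 0 with h | h | h <;> simp [h]⟩⟩
  have hs : ‖s‖ ≤ 1 := lp.norm_le_of_forall_le zero_le_one fun j => by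
    change ‖(SignType.sign (M.mat a i j) : ℝ)‖ ≤ 1
    rcases lt_trichotomy (M.mat a i j) 0 with h | h | h <;> simp [h]
  have hsum : HasSum (fun j => |M.mat a i j|) (M.op ∞ a s i) := by
    refine (M.hasSum_op ∞ a s i).congr_fun fun j => ?_
    exact (self_mul_sign _).symm
  refine ⟨hsum.summable, hsum.tsum_eq.le.trans ?_⟩
  calc M.op ∞ a s i ≤ ‖M.op ∞ a s‖ := (le_abs_self _).trans (Ell.abs_apply_le _ i)
    _ ≤ ‖M.op ∞ a‖ * ‖s‖ := (M.op ∞ a).le_opNorm s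
    _ ≤ ‖M.op ∞ a‖ := mul_le_of_le_one_right (norm_nonneg _) hs

/-- The action on `ℓ^q` is multiplicative. Associativity `(ab)x = a(bx)` is an exchange of the two
summations, which converge absolutely because the rows of `a` and `b` are absolutely summable,
uniformly over the rows of `b`. -/
theorem op_mul (q : ℝ≥0∞) [Fact (1 ≤ q)] (a b : 𝒜) :
    M.op q (M.mul a b) = M.op q a * M.op q b := by
  ext x i
  let F : ι × ι → ℝ := fun jk => M.mat a i jk.1 * (M.mat b jk.1 jk.2 * x jk.2)
  have hb (j : ι) : Summable fun k => |M.mat b j k * x k| := by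
    refine Summable.of_nonneg_of_le (fun _ => abs_nonneg _) (fun k => ?_)
      ((M.summable_abs_mat b j).1.mul_right ‖x‖)
    rw [abs_mul]
    gcongr
    exact Ell.abs_apply_le x k
  have hb' (j : ι) : ∑' k, |M.mat b j k * x k| ≤ ‖M.op ∞ b‖ * ‖x‖ := by
    calc ∑' k, |M.mat b j k * x k| ≤ ∑' k, |M.mat b j k| * ‖x‖ := by
          refine (hb j).tsum_le_tsum (fun k => ?_) ((M.summable_abs_mat b j).1.mul_right ‖x‖)
          rw [abs_mul]
          gcongr
          exact Ell.abs_apply_le x k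
      _ = (∑' k, |M.mat b j k|) * ‖x‖ := tsum_mul_right
      _ ≤ ‖M.op ∞ b‖ * ‖x‖ := by
          gcongr
          exact (M.summable_abs_mat b j).2
  have hF : Summable F := by
    refine Summable.of_norm ((summable_prod_of_nonneg fun _ => norm_nonneg _).2 ⟨fun j => ?_, ?_⟩)
    · simpa [F, abs_mul] using (hb j).mul_left |M.mat a i j|
    · refine Summable.of_nonneg_of_le (fun _ => tsum_nonneg fun _ => norm_nonneg _) (fun j => ?_)
        ((M.summable_abs_mat a i).1.mul_right (‖M.op ∞ b‖ * ‖x‖))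
      calc ∑' k, ‖F (j, k)‖ = |M.mat a i j| * ∑' k, |M.mat b j k * x k| := by
            rw [← tsum_mul_left]
            simp [F, abs_mul]
        _ ≤ _ := by
            gcongr
            exact hb' j
  have h1 : HasSum F (M.op q a (M.op q b x) i) := by
    have := hF.hasSum.prod_fiberwise fun j => (M.hasSum_op q b x j).mul_left (M.mat a i j)
    rw [← this.unique (M.hasSum_op q a (M.op q b x) i)]
    exact hF.hasSum
  have h2 := ((Equiv.prodComm ι ι).hasSum_iff.2 h1).prod_fiberwise (fun k => by
    simpa [F, mul_assoc] using (M.hasSum_mul a b i k).mul_right (x k))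
  exact (M.hasSum_op q (M.mul a b) x i).unique h2

/-- `a` and `b` are inverse to each other as operators on `ℓ²`. -/
def IsInverse (a b : 𝒜) : Prop := M.op 2 a * M.op 2 b = 1 ∧ M.op 2 b * M.op 2 a = 1

variable {M}

theorem IsInverse.symm {a b : 𝒜} (h : M.IsInverse a b) : M.IsInverse b a := ⟨h.2, h.1⟩

theorem IsInverse.op_apply {a b : 𝒜} (h : M.IsInverse a b) (x : Ell ι q) :
    M.op q a (M.op q b x) = x := by
  have := M.op_eq_one_of_op_eq_one ((M.op_mul 2 a b).trans h.1) q
  rw [M.op_mul] at this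
  exact DFunLike.congr_fun this x

/-- The operator on `ℓ^q` of an invertible element, as a linear homeomorphism. -/
noncomputable def IsInverse.equiv {a b : 𝒜} (h : M.IsInverse a b) (q : ℝ≥0∞) [Fact (1 ≤ q)] :
    Ell ι q ≃L[ℝ] Ell ι q :=
  ContinuousLinearEquiv.equivOfInverse (M.op q a) (M.op q b) h.symm.op_apply h.op_apply

theorem IsInverse.coe_equiv {a b : 𝒜} (h : M.IsInverse a b) (q : ℝ≥0∞) [Fact (1 ≤ q)] :
    (h.equiv q : Ell ι q →L[ℝ] Ell ι q) = M.op q a := rfl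

/-- The resolvent identity `b - b' = b (a' - a) b'` for the inverses `b`, `b'` of `a`, `a'`. -/
theorem IsInverse.sub_eq {a b a' b' : 𝒜} (h : M.IsInverse a b) (h' : M.IsInverse a' b') :
    b - b' = M.mul (M.mul b (a' - a)) b' := by
  apply M.op_injective 2
  rw [M.op_mul, M.op_mul, map_sub, map_sub, mul_sub, sub_mul, mul_assoc, h'.1, h.2, mul_one,
    one_mul]

/-- Inversion is continuous along a continuous family as long as the inverses stay bounded. -/
theorem continuous_inverse {X : Type*} [TopologicalSpace X] {A B : X → 𝒜} (hA : Continuous A)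
    {D : ℝ} (hB : ∀ x, ‖B x‖ ≤ D) (h : ∀ x, M.IsInverse (A x) (B x)) : Continuous B := by
  refine continuous_iff_continuousAt.2 fun x => ?_
  refine tendsto_iff_norm_sub_tendsto_zero.2 ?_
  have hlim : Tendsto (fun y => ‖M.mul‖ * (‖M.mul‖ * D * ‖A x - A y‖) * D) (𝓝 x) (𝓝 0) := by
    have : Tendsto (fun y => ‖A x - A y‖) (𝓝 x) (𝓝 0) := by
      simpa using ((continuous_const.sub hA).norm.tendsto x : Tendsto (fun y => ‖A x - A y‖) _ _)
    simpa using ((this.const_mul (‖M.mul‖ * D)).const_mul ‖M.mul‖).mul_const D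
  refine squeeze_zero (fun _ => norm_nonneg _) (fun y => ?_) hlim
  rw [(h y).sub_eq (h x)]
  have hD : 0 ≤ D := (norm_nonneg _).trans (hB x)
  calc ‖M.mul (M.mul (B y) (A x - A y)) (B x)‖
      ≤ ‖M.mul‖ * ‖M.mul (B y) (A x - A y)‖ * ‖B x‖ := M.mul.le_opNorm₂ _ _
    _ ≤ ‖M.mul‖ * (‖M.mul‖ * ‖B y‖ * ‖A x - A y‖) * ‖B x‖ := by
        gcongr
        exact M.mul.le_opNorm₂ _ _
    _ ≤ ‖M.mul‖ * (‖M.mul‖ * D * ‖A x - A y‖) * D := by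
        gcongr
        · exact hB y
        · exact hB x

theorem norm_le_iSup_closedBall_mul {E : Type*} [NormedAddCommGroup E] [NormedSpace ℝ E]
    (L : 𝒜 →L[ℝ] E) (a : 𝒜) : ‖L a‖ ≤ (⨆ b : Metric.closedBall (0 : 𝒜) 1, ‖L b‖) * ‖a‖ := by
  rcases eq_or_ne a 0 with rfl | ha
  · simp
  have ha' : 0 < ‖a‖ := norm_pos_iff.2 ha
  have hbdd : BddAbove (Set.range fun b : Metric.closedBall (0 : 𝒜) 1 => ‖L b‖) := by
    refine ⟨‖L‖, ?_⟩
    rintro _ ⟨b, rfl⟩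
    exact L.unit_le_opNorm _ (mem_closedBall_zero_iff.1 b.2)
  have hmem : ‖a‖⁻¹ • a ∈ Metric.closedBall (0 : 𝒜) 1 := by simp [norm_smul, ha'.ne']
  have := le_ciSup hbdd ⟨_, hmem⟩
  simp only [map_smul, norm_smul, norm_inv, norm_norm] at this
  rwa [inv_mul_le_iff₀ ha', mul_comm] at this

theorem norm_mul_mul_apply_le {E : Type*} [NormedAddCommGroup E] [NormedSpace ℝ E]
    (T : 𝒜 →L[ℝ] E →L[ℝ] E) (P Q : E →L[ℝ] E) (a : 𝒜) (z : E) :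
    ‖P (T a (Q z))‖ ≤ (⨆ b : Metric.closedBall (0 : 𝒜) 1, ‖P * T b * Q‖) * ‖a‖ * ‖z‖ := by
  have := norm_le_iSup_closedBall_mul
    ((ContinuousLinearMap.mulLeftRight ℝ (E →L[ℝ] E) P Q).comp T) a
  simp only [ContinuousLinearMap.comp_apply, ContinuousLinearMap.mulLeftRight_apply] at this
  exact (P * T a * Q).le_of_opNorm_le this z

theorem embConst_nonneg (p : ℝ≥0∞) [Fact (1 ≤ p)] : 0 ≤ M.embConst p :=
  Real.iSup_nonneg fun _ => norm_nonneg _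

theorem norm_op_apply_le_embConst (a : 𝒜) (x : Ell ι p) :
    ‖M.op p a x‖ ≤ M.embConst p * ‖a‖ * ‖x‖ :=
  (M.op p a).le_of_opNorm_le (norm_le_iSup_closedBall_mul (M.op p) a) x

/-! ### Inverses of coercive elements -/

variable (M) in
/-- `m ⟪c, c⟫ ≤ ⟪a c, c⟫` for all `c ∈ ℓ²`. -/
def IsCoerciveWith (m : ℝ) (a : 𝒜) : Prop := ∀ c : Ell ι 2, m * ‖c‖ ^ 2 ≤ inner ℝ (M.op 2 a c) c

theorem isCoerciveWith_iff {m : ℝ} {a : 𝒜} : M.IsCoerciveWith m a ↔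
    ∀ c : Ell ι 2, m * ∑' i, c i * c i ≤ ∑' i, c i * M.op 2 a c i := by
  refine forall_congr' fun c => ?_
  rw [← real_inner_self_eq_norm_sq, lp.inner_eq_tsum, lp.inner_eq_tsum]
  rfl

/-- The Lax–Milgram theorem, with the bound `1 / m` for the inverse. -/
theorem IsCoerciveWith.exists_inverse {m : ℝ} (hm : 0 < m) {a : 𝒜} (ha : M.IsCoerciveWith m a) :
    ∃ T : Ell ι 2 →L[ℝ] Ell ι 2, M.op 2 a * T = 1 ∧ T * M.op 2 a = 1 ∧ ‖T‖ ≤ m⁻¹ := by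
  let B : Ell ι 2 →L[ℝ] Ell ι 2 →L[ℝ] ℝ := (innerSL ℝ).comp (M.op 2 a)
  have hB : IsCoercive B := ⟨m, hm, fun u => by
    simpa [B, innerSL_apply_apply, mul_assoc, pow_two] using ha u⟩
  let e := hB.continuousLinearEquivOfBilin
  have he (u : Ell ι 2) : M.op 2 a u = e u :=
    hB.unique_continuousLinearEquivOfBilin fun w => rfl
  refine ⟨e.symm, ?_, ?_, ?_⟩
  · ext1 u
    simp [he]
  · ext1 u
    simp [he]
  · refine ContinuousLinearMap.opNorm_le_bound _ (inv_nonneg.2 hm.le) fun v => ?_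
    obtain ⟨u, rfl⟩ := e.surjective v
    rw [ContinuousLinearEquiv.coe_coe, e.symm_apply_apply, inv_mul_eq_div, le_div_iff₀ hm]
    rcases (norm_nonneg u).eq_or_lt with h0 | h0
    · simp [← h0]
    refine le_of_mul_le_mul_right ?_ h0
    calc ‖u‖ * m * ‖u‖ = m * ‖u‖ ^ 2 := by ring
      _ ≤ inner ℝ (M.op 2 a u) u := ha u
      _ ≤ ‖e u‖ * ‖u‖ := by
        rw [he]
        exact real_inner_le_norm _ _

/-- Under norm control, the inverses of the uniformly coercive elements of a ball of `𝒜` lie in a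
ball of `𝒜`: the controlling function is bounded on compact sets. -/
theorem AdmitsNormControl.exists_inverse (hctrl : M.AdmitsNormControl) {m : ℝ} (hm : 0 < m)
    (C : ℝ) : ∃ D : ℝ, ∀ a : 𝒜, ‖a‖ ≤ C → M.IsCoerciveWith m a →
      ∃ b, M.IsInverse a b ∧ ‖b‖ ≤ D := by
  obtain ⟨h, hcont, hh⟩ := hctrl
  obtain ⟨D, hD⟩ := ((isCompact_Icc (a := ((0 : ℝ≥0), (0 : ℝ≥0)))
    (b := (C.toNNReal, m⁻¹.toNNReal))).image hcont).bddAbove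
  refine ⟨D, fun a ha hco => ?_⟩
  obtain ⟨T, h1, h2, hT⟩ := hco.exists_inverse hm
  obtain ⟨b, rfl, hb⟩ := hh a T h1 h2
  refine ⟨b, ⟨h1, h2⟩, NNReal.coe_le_coe.2 (hb.trans (hD ⟨_, ⟨by simp, ?_, ?_⟩, rfl⟩))⟩
  · exact NNReal.le_toNNReal_of_coe_le ha
  · exact NNReal.le_toNNReal_of_coe_le hT

/-! ### Increments of a map with gradient in `𝒜` -/

/-- The average `∫₀¹ G (y + t (x - y)) dt` of the gradient over the segment from `y` to `x`. -/
noncomputable def chord (G : Ell ι p → 𝒜) (x y : Ell ι p) : 𝒜 :=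
  ∫ t in (0 : ℝ)..1, G (y + t • (x - y))

section Chord

variable {G : Ell ι p → 𝒜}

omit [NormedSpace ℝ 𝒜] in
theorem intervalIntegrable_segment (hG : Continuous G) (x y : Ell ι p) :
    IntervalIntegrable (fun t : ℝ => G (y + t • (x - y))) volume 0 1 :=
  (hG.comp (by fun_prop)).intervalIntegrable 0 1

omit [Fact (1 ≤ p)] in
theorem norm_chord_le {C : ℝ} (hC : ∀ x, ‖G x‖ ≤ C) (x y : Ell ι p) : ‖chord G x y‖ ≤ C := by
  simpa [chord] using intervalIntegral.norm_integral_le_of_norm_le_const (a := 0) (b := 1)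
    fun t _ => hC (y + t • (x - y))

variable [CompleteSpace 𝒜]

/-- The continuity of `chord G` at the diagonal: for nearby end points the whole segment is near. -/
theorem tendsto_chord (hG : Continuous G) (z : Ell ι p) :
    Tendsto (fun xy : Ell ι p × Ell ι p => chord G xy.1 xy.2) (𝓝 (z, z)) (𝓝 (G z)) := by
  refine Metric.tendsto_nhds.2 fun ε hε => ?_
  obtain ⟨δ, hδ, hball⟩ :=
    Metric.continuousAt_iff.1 (hG.continuousAt (x := z)) (ε / 2) (half_pos hε)
  have hnhds : ∀ᶠ y in 𝓝 z, y ∈ Metric.ball z δ := Metric.ball_mem_nhds z hδ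
  rw [nhds_prod_eq]
  filter_upwards [hnhds.prod_mk hnhds] with ⟨x, y⟩ ⟨hx, hy⟩
  have heq : chord G x y - G z = ∫ t in (0 : ℝ)..1, (G (y + t • (x - y)) - G z) := by
    rw [intervalIntegral.integral_sub (intervalIntegrable_segment hG x y) (by simp)]
    simp [chord]
  have hle := intervalIntegral.norm_integral_le_of_norm_le_const (a := 0) (b := 1) (C := ε / 2)
    (f := fun t : ℝ => G (y + t • (x - y)) - G z) fun t ht => by
      rw [Set.uIoc_of_le zero_le_one] at ht
      rw [← dist_eq_norm]
      exact (hball ((convex_ball z δ).add_smul_sub_mem hy hx ⟨ht.1.le, ht.2⟩)).le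
  rw [← heq, sub_zero, abs_one, mul_one] at hle
  rw [dist_eq_norm]
  exact hle.trans_lt (half_lt_self hε)

/-- Coercivity is a closed convex condition, hence it passes to averages. -/
theorem isCoerciveWith_chord (hG : Continuous G) {m : ℝ} (hm : ∀ x, M.IsCoerciveWith m (G x))
    (x y : Ell ι p) : M.IsCoerciveWith m (chord G x y) := by
  intro c
  let φ : 𝒜 →L[ℝ] ℝ := (innerSL ℝ c).comp ((M.op 2).flip c)
  have hφ (a : 𝒜) : φ a = inner ℝ (M.op 2 a c) c := real_inner_comm (M.op 2 a c) c
  rw [← hφ, chord, ← φ.intervalIntegral_comp_comm (intervalIntegrable_segment hG x y)]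
  have := intervalIntegral.integral_mono_on (μ := volume) (zero_le_one (α := ℝ))
    (f := fun _ => m * ‖c‖ ^ 2) (g := fun t : ℝ => φ (G (y + t • (x - y)))) (by simp)
    ((φ.continuous.comp (hG.comp (by fun_prop))).intervalIntegrable 0 1)
    fun t _ => by
      rw [hφ]
      exact hm _ c
  simpa using this

/-- The fundamental theorem of calculus along the segment from `y` to `x`. -/
theorem HasBoundedContGradient.sub_eq {g : Ell ι p → Ell ι p} (h : M.HasBoundedContGradient g G)
    (x y : Ell ι p) : g x - g y = M.op p (chord G x y) (x - y) := by
  let φ : 𝒜 →L[ℝ] Ell ι p := (M.op p).flip (x - y)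
  have hderiv (t : ℝ) :
      HasDerivAt (fun s : ℝ => g (y + s • (x - y))) (φ (G (y + t • (x - y)))) t := by
    have h0 : HasDerivAt (fun s : ℝ => g (y + t • (x - y) + s • (x - y)))
        (φ (G (y + t • (x - y)))) (t - t) := by
      rw [sub_self]
      exact h.gradient (y + t • (x - y)) (x - y)
    refine (h0.comp_sub_const t t).congr_of_eventuallyEq (Eventually.of_forall fun s => ?_)
    dsimp only
    rw [add_assoc, ← add_smul, add_sub_cancel]
  have := intervalIntegral.integral_eq_sub_of_hasDerivAt (a := 0) (b := 1)
    (fun t _ => hderiv t)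
    ((φ.continuous.comp (h.continuous.comp (by fun_prop))).intervalIntegrable 0 1)
  rw [φ.intervalIntegral_comp_comm (intervalIntegrable_segment h.continuous x y)] at this
  simp only [one_smul, zero_smul, add_zero, add_sub_cancel] at this
  exact this.symm

end Chord

variable (M) in
/-- Every increment of `g` is given by a matrix of norm at most `C` in `𝒜`. -/
def HasIncrements (C : ℝ) (g : Ell ι p → Ell ι p) : Prop :=
  ∀ x y, ∃ a : 𝒜, ‖a‖ ≤ C ∧ g x - g y = M.op p a (x - y)

theorem HasBoundedContGradient.hasIncrements [CompleteSpace 𝒜] {g : Ell ι p → Ell ι p}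
    {G : Ell ι p → 𝒜} (h : M.HasBoundedContGradient g G) : M.HasIncrements (⨆ z, ‖G z‖) g := by
  intro x y
  obtain ⟨C, hC⟩ := h.bounded
  refine ⟨chord G x y, norm_chord_le (fun z => ?_) x y, h.sub_eq x y⟩
  exact le_ciSup (f := fun z => ‖G z‖) ⟨C, by rintro _ ⟨w, rfl⟩; exact hC w⟩ z

/-! ### Invertibility on the smaller spaces -/

theorem hasStrictFDerivAt_of_increments {E : Type*} [NormedAddCommGroup E] [NormedSpace ℝ E]
    {F : E → E} {A : E × E → E →L[ℝ] E} (hFA : ∀ y z, F y - F z = A (y, z) (y - z)) {x : E}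
    {L : E →L[ℝ] E} (hA : Tendsto A (𝓝 (x, x)) (𝓝 L)) : HasStrictFDerivAt F L x := by
  rw [hasStrictFDerivAt_iff_isLittleO, Asymptotics.isLittleO_iff]
  intro c hc
  filter_upwards [Metric.tendsto_nhds.1 hA c hc] with yz hyz
  rw [hFA, ← sub_apply]
  exact ContinuousLinearMap.le_of_opNorm_le _ (dist_eq_norm (A yz) L ▸ hyz.le) _

/-- Hadamard's global inverse function theorem for maps that are expanding up to a constant: the
range is open by the inverse function theorem and closed by completeness. -/
theorem exists_homeomorph_of_antilipschitz {E : Type*} [NormedAddCommGroup E] [NormedSpace ℝ E]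
    [CompleteSpace E] {F : E → E} {F' : E → E ≃L[ℝ] E}
    (hF : ∀ x, HasStrictFDerivAt F (F' x : E →L[ℝ] E) x) (hu : UniformContinuous F)
    {K : ℝ≥0} (hK : AntilipschitzWith K F) :
    ∃ e : E ≃ₜ E, (∀ x, e x = F x) ∧
      ∀ y, HasFDerivAt e.symm ((F' (e.symm y)).symm : E →L[ℝ] E) y := by
  have hopen : IsOpenMap F := isOpenMap_of_hasStrictFDerivAt_equiv hF
  have hsurj : Function.Surjective F := by
    have := hK.isClosed_range hu
    exact Set.range_eq_univ.1 (IsClopen.eq_univ ⟨this, hopen.isOpen_range⟩ (Set.range_nonempty F))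
  let e : E ≃ₜ E :=
    (Equiv.ofBijective F ⟨hK.injective, hsurj⟩).toHomeomorphOfContinuousOpen hu.continuous hopen
  refine ⟨e, fun _ => rfl, fun y => ?_⟩
  have hy : HasFDerivAt e (F' (e.symm y) : E →L[ℝ] E) (e.symm y) := (hF (e.symm y)).hasFDerivAt
  exact hy.of_local_left_inverse e.symm.continuous.continuousAt
    (Eventually.of_forall e.apply_symm_apply)

/-- A map with coercive gradient restricts to a homeomorphism of each smaller space `ℓ^p`. The
restriction inherits the increments of `f`, and both these and their inverses are bounded on
`ℓ^p`. -/
theorem HasBoundedContGradient.exists_homeomorph [CompleteSpace 𝒜] (hctrl : M.AdmitsNormControl)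
    {p₀ : ℝ≥0∞} [Fact (1 ≤ p₀)] {f : Ell ι p₀ → Ell ι p₀} (hf0 : f 0 = 0) {G : Ell ι p₀ → 𝒜}
    (hG : M.HasBoundedContGradient f G) {m : ℝ} (hm : 0 < m)
    (hco : ∀ x, M.IsCoerciveWith m (G x)) (hp : p ≤ p₀) :
    ∃ (F : Ell ι p ≃ₜ Ell ι p) (K : Ell ι p → 𝒜),
      (∀ x, Ell.incl hp (F x) = f (Ell.incl hp x)) ∧ M.HasBoundedContGradient F.symm K := by
  obtain ⟨C, hC⟩ := hG.bounded
  obtain ⟨D, hD⟩ := hctrl.exists_inverse hm C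
  choose B hB hBD using fun x => hD (G x) (hC x) (hco x)
  let A (x y : Ell ι p) : 𝒜 := chord G (Ell.incl hp x) (Ell.incl hp y)
  let F (x : Ell ι p) : Ell ι p := M.op p (A x 0) x
  have hFf (x : Ell ι p) : Ell.incl hp (F x) = f (Ell.incl hp x) := by
    rw [← M.op_incl hp, ← sub_zero (f _), ← hf0, hG.sub_eq]
    exact congrArg _ (sub_zero _).symm
  have hFA (x y : Ell ι p) : F x - F y = M.op p (A x y) (x - y) := by
    apply Ell.incl_injective hp
    rw [Ell.incl_sub, hFf, hFf, ← M.op_incl hp, hG.sub_eq, Ell.incl_sub]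
  have hE : 0 ≤ M.embConst p := embConst_nonneg p
  have hlip : LipschitzWith (M.embConst p * C).toNNReal F := by
    refine LipschitzWith.of_dist_le_mul fun x y => ?_
    rw [dist_eq_norm, dist_eq_norm, hFA]
    refine (norm_op_apply_le_embConst _ _).trans (mul_le_mul_of_nonneg_right ?_ (norm_nonneg _))
    exact (mul_le_mul_of_nonneg_left (norm_chord_le hC _ _) hE).trans
      (Real.le_coe_toNNReal _)
  have hanti : AntilipschitzWith (M.embConst p * D).toNNReal F := by
    refine AntilipschitzWith.of_le_mul_dist fun x y => ?_
    obtain ⟨b, hb, hbD⟩ := hD (A x y) (norm_chord_le hC _ _)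
      (isCoerciveWith_chord hG.continuous hco _ _)
    rw [dist_eq_norm, dist_eq_norm, hFA]
    calc ‖x - y‖ = ‖M.op p b (M.op p (A x y) (x - y))‖ := by rw [hb.symm.op_apply]
      _ ≤ M.embConst p * ‖b‖ * ‖M.op p (A x y) (x - y)‖ := norm_op_apply_le_embConst b _
      _ ≤ (M.embConst p * D).toNNReal * ‖M.op p (A x y) (x - y)‖ := by
        gcongr
        exact (mul_le_mul_of_nonneg_left hbD hE).trans (Real.le_coe_toNNReal _)
  have hstrict (x : Ell ι p) : HasStrictFDerivAt F
      (((hB (Ell.incl hp x)).equiv p : Ell ι p ≃L[ℝ] Ell ι p) : Ell ι p →L[ℝ] Ell ι p) x := by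
    have hincl := (Ell.continuous_incl (ι := ι) hp).tendsto x
    have hA : Tendsto (fun yz : Ell ι p × Ell ι p => A yz.1 yz.2) (𝓝 (x, x))
        (𝓝 (G (Ell.incl hp x))) := by
      refine (tendsto_chord hG.continuous (Ell.incl hp x)).comp
        (f := fun yz : Ell ι p × Ell ι p => (Ell.incl hp yz.1, Ell.incl hp yz.2)) ?_
      rw [nhds_prod_eq, nhds_prod_eq]
      exact hincl.prodMap hincl
    have hopA := ((M.op p).continuous.tendsto (G (Ell.incl hp x))).comp hA
    rw [IsInverse.coe_equiv]
    exact hasStrictFDerivAt_of_increments hFA hopA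
  obtain ⟨e, heF, he'⟩ := exists_homeomorph_of_antilipschitz hstrict hlip.uniformContinuous hanti
  refine ⟨e, fun y => B (Ell.incl hp (e.symm y)), fun x => by rw [heF, hFf], ?_,
    ⟨D, fun y => hBD _⟩, ?_⟩
  · exact fun y c => (he' y).hasLineDerivAt c
  · exact (continuous_inverse hG.continuous hBD hB).comp
      ((Ell.continuous_incl hp).comp e.symm.continuous)

/-! ### Extension to the larger spaces -/

variable (M) in
/-- The quantity `sup_{‖a‖_𝒜 ≤ 1} ‖P_S a (1 - P_{S'})‖_{B(ℓ^∞)}`. -/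
noncomputable def bandConst (S S' : Finset ι) : ℝ :=
  ⨆ a : Metric.closedBall (0 : 𝒜) 1,
    ‖Ell.proj S * M.op ∞ (a : 𝒜) * (1 - Ell.proj S')‖

theorem bandConst_nonneg (S S' : Finset ι) : 0 ≤ M.bandConst S S' :=
  Real.iSup_nonneg fun _ => norm_nonneg _

/-- The approximation in `B(ℓ^∞)` also controls the coordinates of the action on `ℓ^p`. -/
theorem abs_op_apply_sub_trunc_le {S : Finset ι} (S' : Finset ι) {i : ι} (hi : i ∈ S) (a : 𝒜)
    (z : Ell ι p) : |M.op p a (z - Ell.trunc p S' z) i| ≤ M.bandConst S S' * ‖a‖ * ‖z‖ := by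
  have h1 : M.op p a (z - Ell.trunc p S' z) i
      = Ell.proj S (M.op ∞ a ((1 - Ell.proj S') (Ell.incl le_top z))) i := by
    rw [Ell.proj_apply, Set.indicator_of_mem (Finset.mem_coe.2 hi)]
    exact congrArg (fun w : Ell ι ∞ => w i) (M.op_incl le_top a (z - Ell.trunc p S' z)).symm
  rw [h1]
  refine (Ell.abs_apply_le _ i).trans ((norm_mul_mul_apply_le (M.op ∞) _ _ a _).trans ?_)
  exact mul_le_mul_of_nonneg_left (Ell.norm_incl_le le_top z)
    (mul_nonneg (bandConst_nonneg S S') (norm_nonneg a))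

theorem abs_op_apply_le {S : Finset ι} (S' : Finset ι) {i : ι} (hi : i ∈ S) (a : 𝒜)
    (z : Ell ι p) : |M.op p a z i|
      ≤ M.bandConst S S' * ‖a‖ * ‖z‖ + M.embConst p * ‖a‖ * ∑ j ∈ S', |z j| := by
  have hsplit : M.op p a z i
      = M.op p a (z - Ell.trunc p S' z) i + M.op p a (Ell.trunc p S' z) i := by
    rw [map_sub, lp.coeFn_sub, Pi.sub_apply, sub_add_cancel]
  rw [hsplit]
  refine (abs_add_le _ _).trans (add_le_add (abs_op_apply_sub_trunc_le S' hi a z) ?_)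
  refine (Ell.abs_apply_le _ i).trans ((norm_op_apply_le_embConst a _).trans ?_)
  exact mul_le_mul_of_nonneg_left (Ell.norm_trunc_le_sum S' z)
    (mul_nonneg (embConst_nonneg p) (norm_nonneg a))

variable (M) in
/-- A sequence of finite sets as in the definition of `BandApproximable`. -/
structure IsBandExhaustion (S : ℕ → Finset ι) : Prop where
  subset_succ : ∀ m, S m ⊆ S (m + 1)
  exists_mem : ∀ i, ∃ m, i ∈ S m
  tendsto_bandConst : Tendsto (fun m => M.bandConst (S m) (S (m + 1))) atTop (𝓝 0)

section Extension

variable {S : ℕ → Finset ι}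

/-- Bounded families in `𝒜` map bounded, pointwise null families to pointwise null families. Each
coordinate of the image splits into the contribution of finitely many columns and a remainder that
is uniformly small over the family. -/
theorem IsBandExhaustion.tendsto_op_apply_zero (hS : M.IsBandExhaustion S) {L : Type*}
    {l : Filter L} {A : L → 𝒜} {z : L → Ell ι p} {C R : ℝ} (hA : ∀ n, ‖A n‖ ≤ C)
    (hz : ∀ n, ‖z n‖ ≤ R) (hz0 : ∀ i, Tendsto (fun n => z n i) l (𝓝 0)) (i : ι) :
    Tendsto (fun n => M.op p (A n) (z n) i) l (𝓝 0) := by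
  rcases isEmpty_or_nonempty L with hL | ⟨⟨n₀⟩⟩
  · exact tendsto_of_isEmpty
  have hC : 0 ≤ C := (norm_nonneg _).trans (hA n₀)
  have hR : 0 ≤ R := (norm_nonneg _).trans (hz n₀)
  have hE : 0 ≤ M.embConst p := embConst_nonneg p
  obtain ⟨k₀, hk₀⟩ := hS.exists_mem i
  refine Metric.tendsto_nhds.2 fun η hη => ?_
  have hlim : Tendsto (fun k => M.bandConst (S k) (S (k + 1)) * C * R) atTop (𝓝 0) := by
    simpa using (hS.tendsto_bandConst.mul_const C).mul_const R
  obtain ⟨k, hkη, hk⟩ := ((hlim.eventually_lt_const (half_pos hη)).and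
    (eventually_ge_atTop k₀)).exists
  have hlim' : Tendsto (fun n => M.embConst p * C * ∑ j ∈ S (k + 1), |z n j|) l (𝓝 0) := by
    simpa using (tendsto_finsetSum (S (k + 1)) fun j _ => (hz0 j).abs).const_mul
      (M.embConst p * C)
  have hik : i ∈ S k := monotone_nat_of_le_succ hS.subset_succ hk hk₀
  filter_upwards [hlim'.eventually_lt_const (half_pos hη)] with n hn
  rw [dist_zero_right, Real.norm_eq_abs]
  have hB : 0 ≤ M.bandConst (S k) (S (k + 1)) := bandConst_nonneg _ _
  calc |M.op p (A n) (z n) i|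
      ≤ M.bandConst (S k) (S (k + 1)) * ‖A n‖ * ‖z n‖
        + M.embConst p * ‖A n‖ * ∑ j ∈ S (k + 1), |z n j| := abs_op_apply_le _ hik _ _
    _ ≤ M.bandConst (S k) (S (k + 1)) * C * R
        + M.embConst p * C * ∑ j ∈ S (k + 1), |z n j| := by
      gcongr
      · exact hA n
      · exact hz n
      · exact hA n
    _ < η := by linarith

variable {p₀ : ℝ≥0∞} [Fact (1 ≤ p₀)] {C : ℝ} {g : Ell ι p₀ → Ell ι p₀}

/-- A map with increments in a ball of `𝒜` is continuous for bounded pointwise convergence. -/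
theorem IsBandExhaustion.tendsto_sub_apply (hS : M.IsBandExhaustion S) (hg : M.HasIncrements C g)
    (hp : p₀ ≤ p) {L : Type*} {l : Filter L} {x y : L → Ell ι p₀} {R : ℝ}
    (hxy : ∀ n, ‖Ell.incl hp (x n - y n)‖ ≤ R)
    (h0 : ∀ i, Tendsto (fun n => x n i - y n i) l (𝓝 0)) (i : ι) :
    Tendsto (fun n => g (x n) i - g (y n) i) l (𝓝 0) := by
  choose A hA hgA using fun n => hg (x n) (y n)
  refine (hS.tendsto_op_apply_zero hA hxy h0 i).congr fun n => ?_
  rw [M.op_incl hp, ← hgA]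
  rfl

theorem HasIncrements.norm_incl_sub_le (hg : M.HasIncrements C g) (hp : p₀ ≤ p) (x y : Ell ι p₀) :
    ‖Ell.incl hp (g x - g y)‖ ≤ C * M.embConst p * ‖Ell.incl hp (x - y)‖ := by
  obtain ⟨a, ha, hga⟩ := hg x y
  rw [hga, ← M.op_incl hp]
  refine (norm_op_apply_le_embConst _ _).trans (mul_le_mul_of_nonneg_right ?_ (norm_nonneg _))
  rw [mul_comm]
  exact mul_le_mul_of_nonneg_right ha (embConst_nonneg p)

theorem HasIncrements.norm_incl_le (hg : M.HasIncrements C g) (hg0 : g 0 = 0) (hp : p₀ ≤ p)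
    (x : Ell ι p₀) : ‖Ell.incl hp (g x)‖ ≤ C * M.embConst p * ‖Ell.incl hp x‖ := by
  simpa only [hg0, sub_zero] using hg.norm_incl_sub_le hp x 0

/-- `F` is the coordinatewise limit of `g` along truncations; the values of `g` on truncations
determine `F` on all of `ℓ^p`, including `p = ∞`, where the truncations are not dense. -/
theorem IsBandExhaustion.exists_extension (hS : M.IsBandExhaustion S)
    (hg : M.HasIncrements C g) (hg0 : g 0 = 0) (hp : p₀ ≤ p) : ∃ F : Ell ι p → Ell ι p,
      (∀ x i, Tendsto (fun m => g (Ell.trunc p₀ (S m) x) i) atTop (𝓝 (F x i))) ∧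
      ∀ x y, ‖F x - F y‖ ≤ C * M.embConst p * ‖x - y‖ := by
  have hC : 0 ≤ C := by
    obtain ⟨a, ha, -⟩ := hg 0 0
    exact (norm_nonneg a).trans ha
  have hCE : 0 ≤ C * M.embConst p := mul_nonneg hC (embConst_nonneg p)
  have hconv (x : Ell ι p) (i : ι) :
      ∃ l, Tendsto (fun m => g (Ell.trunc p₀ (S m) x) i) atTop (𝓝 l) := by
    refine cauchySeq_tendsto_of_complete ?_
    rw [cauchySeq_iff_tendsto_dist_atTop_0]
    have := hS.tendsto_sub_apply hg hp (l := atTop) (R := ‖x‖ + ‖x‖)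
      (x := fun mn : ℕ × ℕ => Ell.trunc p₀ (S mn.1) x) (y := fun mn => Ell.trunc p₀ (S mn.2) x)
      (fun mn => ?_) (fun j => ?_) i
    · simpa [Real.dist_eq] using this.abs
    · rw [Ell.incl_sub, Ell.incl_trunc, Ell.incl_trunc]
      exact (norm_sub_le _ _).trans
        (add_le_add (Ell.norm_trunc_le _ _) (Ell.norm_trunc_le _ _))
    · have hj := Ell.tendsto_trunc_apply (q := p₀) hS.subset_succ hS.exists_mem x j
      rw [← prod_atTop_atTop_eq]
      simpa using (hj.comp tendsto_fst).sub (hj.comp tendsto_snd)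
  -- Limits of bounded coordinatewise convergent sequences stay in `ℓ^p`.
  choose F₀ hF₀ using hconv
  have hmem (x : Ell ι p) : Memℓp (F₀ x) p := by
    refine lp.memℓp_of_tendsto (F := fun m => Ell.incl hp (g (Ell.trunc p₀ (S m) x))) ?_
      (tendsto_pi_nhds.2 (hF₀ x))
    refine isBounded_iff_forall_norm_le.2 ⟨C * M.embConst p * ‖x‖, ?_⟩
    rintro _ ⟨m, rfl⟩
    refine (hg.norm_incl_le hg0 hp _).trans (mul_le_mul_of_nonneg_left ?_ hCE)
    exact Ell.norm_trunc_le _ _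
  refine ⟨fun x => ⟨F₀ x, hmem x⟩, hF₀, fun x y => ?_⟩
  refine lp.norm_le_of_tendsto (l := atTop)
    (F := fun m => Ell.incl hp (g (Ell.trunc p₀ (S m) x) - g (Ell.trunc p₀ (S m) y)))
    (Eventually.of_forall fun m => ?_) (tendsto_pi_nhds.2 fun i => (hF₀ x i).sub (hF₀ y i))
  refine (hg.norm_incl_sub_le hp _ _).trans (mul_le_mul_of_nonneg_left ?_ hCE)
  rw [← Ell.trunc_sub, Ell.incl_trunc]
  exact Ell.norm_trunc_le _ _

/-- The extension is continuous for bounded pointwise convergence, tested along sequences of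
`ℓ^{p₀}`. -/
theorem IsBandExhaustion.tendsto_apply (hS : M.IsBandExhaustion S) (hg : M.HasIncrements C g)
    (hp : p₀ ≤ p) {F : Ell ι p → Ell ι p}
    (hF : ∀ x i, Tendsto (fun m => g (Ell.trunc p₀ (S m) x) i) atTop (𝓝 (F x i)))
    {u : ℕ → Ell ι p₀} {x : Ell ι p} {R : ℝ} (hu : ∀ m, ‖Ell.incl hp (u m)‖ ≤ R)
    (hux : ∀ i, Tendsto (fun m => u m i) atTop (𝓝 (x i))) (i : ι) :
    Tendsto (fun m => g (u m) i) atTop (𝓝 (F x i)) := by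
  have := hS.tendsto_sub_apply hg hp (l := atTop) (R := R + ‖x‖) (x := u)
    (y := fun m => Ell.trunc p₀ (S m) x) (fun m => ?_) (fun j => ?_) i
  · simpa using this.add (hF x i)
  · rw [Ell.incl_sub, Ell.incl_trunc]
    exact (norm_sub_le _ _).trans (add_le_add (hu m) (Ell.norm_trunc_le _ _))
  · simpa using (hux j).sub
      (Ell.tendsto_trunc_apply (q := p₀) hS.subset_succ hS.exists_mem x j)

theorem IsBandExhaustion.extension_incl (hS : M.IsBandExhaustion S)
    (hg : M.HasIncrements C g) (hp : p₀ ≤ p) {F : Ell ι p → Ell ι p}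
    (hF : ∀ x i, Tendsto (fun m => g (Ell.trunc p₀ (S m) x) i) atTop (𝓝 (F x i)))
    (x : Ell ι p₀) : F (Ell.incl hp x) = Ell.incl hp (g x) := by
  ext i
  exact tendsto_nhds_unique (hS.tendsto_apply hg hp hF (u := fun _ => x) (fun _ => le_rfl)
    (fun _ => tendsto_const_nhds) i) tendsto_const_nhds

/-- The values of `g` on the truncations of `x` converge pointwise and boundedly to `F x`, so `F'`
can be evaluated at `F x` along them. -/
theorem IsBandExhaustion.leftInverse_extension (hS : M.IsBandExhaustion S) {C' : ℝ}
    {g' : Ell ι p₀ → Ell ι p₀}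
    (hg : M.HasIncrements C g) (hg0 : g 0 = 0) (hg' : M.HasIncrements C' g')
    (hinv : ∀ x, g' (g x) = x) (hp : p₀ ≤ p) {F F' : Ell ι p → Ell ι p}
    (hF : ∀ x i, Tendsto (fun m => g (Ell.trunc p₀ (S m) x) i) atTop (𝓝 (F x i)))
    (hF' : ∀ x i, Tendsto (fun m => g' (Ell.trunc p₀ (S m) x) i) atTop (𝓝 (F' x i))) :
    Function.LeftInverse F' F := by
  intro x
  ext i
  have hCE : 0 ≤ C * M.embConst p := by
    obtain ⟨a, ha, -⟩ := hg 0 0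
    exact mul_nonneg ((norm_nonneg a).trans ha) (embConst_nonneg p)
  refine tendsto_nhds_unique (hS.tendsto_apply hg' hp hF' (R := C * M.embConst p * ‖x‖)
    (u := fun m => g (Ell.trunc p₀ (S m) x)) (fun m => ?_) (hF x) i) ?_
  · refine (hg.norm_incl_le hg0 hp _).trans (mul_le_mul_of_nonneg_left ?_ hCE)
    exact Ell.norm_trunc_le _ _
  · simp only [hinv]
    exact Ell.tendsto_trunc_apply hS.subset_succ hS.exists_mem x i

/-- A homeomorphism of `ℓ^{p₀}` such that it and its inverse have increments in balls of `𝒜`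
extends to the larger sequence spaces. -/
theorem IsBandExhaustion.exists_homeomorph_extension (hS : M.IsBandExhaustion S) {C' : ℝ}
    {e : Ell ι p₀ ≃ Ell ι p₀}
    (he : M.HasIncrements C e) (he0 : e 0 = 0) (he' : M.HasIncrements C' e.symm)
    (hp : p₀ ≤ p) : ∃ F : Ell ι p ≃ₜ Ell ι p,
      (∀ x, F (Ell.incl hp x) = Ell.incl hp (e x)) ∧
      (∀ x y, ‖F x - F y‖ ≤ C * M.embConst p * ‖x - y‖) ∧
      (∀ x y, ‖F.symm x - F.symm y‖ ≤ C' * M.embConst p * ‖x - y‖) := by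
  have he0' : e.symm 0 = 0 := by rw [Equiv.symm_apply_eq, he0]
  obtain ⟨F, hF, hFlip⟩ := hS.exists_extension he he0 hp
  obtain ⟨F', hF', hFlip'⟩ := hS.exists_extension he' he0' hp
  have hcont {f : Ell ι p → Ell ι p} {D : ℝ} (h : ∀ x y, ‖f x - f y‖ ≤ D * ‖x - y‖) :
      Continuous f := (LipschitzWith.of_dist_le' fun x y => by
    simpa only [dist_eq_norm] using h x y).continuous
  exact ⟨⟨⟨F, F', hS.leftInverse_extension he he0 he' e.symm_apply_apply hp hF hF',
    hS.leftInverse_extension he' he0' he e.apply_symm_apply hp hF' hF⟩, hcont hFlip, hcont hFlip'⟩,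
    hS.extension_incl he hp hF, hFlip, hFlip'⟩

end Extension

end MatrixAlgebra

theorem mainTheorem1 {ι : Type*} [Countable ι]
    {𝒜 : Type*} [NormedAddCommGroup 𝒜] [NormedSpace ℝ 𝒜] [CompleteSpace 𝒜]
    (M : MatrixAlgebra ι 𝒜) (hctrl : M.AdmitsNormControl) (hband : M.BandApproximable)
    (p₀ : ℝ≥0∞) [Fact (1 ≤ p₀)] (hp₀ : 2 ≤ p₀)
    (f : Ell ι p₀ → Ell ι p₀) (hf : Continuous f) (hf0 : f 0 = 0)
    (G : Ell ι p₀ → 𝒜) (hG : M.HasBoundedContGradient f G)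
    (m₀ : ℝ) (hm₀ : 0 < m₀)
    (hmono : ∀ (x : Ell ι p₀) (c : Ell ι 2),
      m₀ * ∑' i, c i * c i ≤ ∑' i, c i * M.op 2 (G x) c i) :
    -- `f` has an inverse `e.symm` on `ℓ^{p₀}`, with gradient `H`; this is the case `p = p₀` of (i)
    ∃ (e : Ell ι p₀ ≃ₜ Ell ι p₀) (H : Ell ι p₀ → 𝒜),
      (∀ x, e x = f x) ∧ M.HasBoundedContGradient e.symm H ∧
      -- (i)
      (∀ (p : ℝ≥0∞) [Fact (1 ≤ p)] (hp : p ≤ p₀),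
        ∃ (F : Ell ι p ≃ₜ Ell ι p) (K : Ell ι p → 𝒜),
          (∀ x, Ell.incl hp (F x) = f (Ell.incl hp x)) ∧
          M.HasBoundedContGradient F.symm K) ∧
      -- (ii)
      (∀ (p : ℝ≥0∞) [Fact (1 ≤ p)] (hp : p₀ < p),
        ∃ F : Ell ι p ≃ₜ Ell ι p,
          (∀ x, F (Ell.incl hp.le x) = Ell.incl hp.le (f x)) ∧
          (∀ x x', ‖F x - F x'‖ ≤ (⨆ z, ‖G z‖) * M.embConst p * ‖x - x'‖) ∧
          (∀ x x', ‖F.symm x - F.symm x'‖ ≤ (⨆ z, ‖H z‖) * M.embConst p * ‖x - x'‖)) := by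
  have hco (x : Ell ι p₀) : M.IsCoerciveWith m₀ (G x) :=
    MatrixAlgebra.isCoerciveWith_iff.2 (hmono x)
  obtain ⟨S, hS, hS', hband⟩ := hband
  obtain ⟨e, H, hef, hH⟩ := hG.exists_homeomorph hctrl hf0 hm₀ hco le_rfl
  have hef' : ⇑e = f := funext fun x => by simpa only [Ell.incl_self] using hef x
  refine ⟨e, H, congrFun hef', hH, fun p _ hp => hG.exists_homeomorph hctrl hf0 hm₀ hco hp,
    fun p _ hp => ?_⟩
  have he : M.HasIncrements (⨆ z, ‖G z‖) e.toEquiv := by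
    change M.HasIncrements _ ⇑e
    rw [hef']
    exact hG.hasIncrements
  have hS : M.IsBandExhaustion S := ⟨hS, hS', hband⟩
  obtain ⟨F, hF, hlip, hlip'⟩ := hS.exists_homeomorph_extension he
    ((congrFun hef' 0).trans hf0) hH.hasIncrements hp.le
  exact ⟨F, fun x => by rw [← hef']; exact hF x, hlip, hlip'⟩
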